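/- For a real random variable $X$ put $\|X\|_{\psi_2}=\inf\{t>0:\ \mathbb E\exp(X^2/t^2)\le 2\}$. For $K\ge 0$ and a positive semidefinite $\Sigma\in\mathbb R^{d\times d}$, write $\mathbf x\sim subG_K(\Sigma)$ if $\mathbf x$ is a random vector in $\mathbb R^d$ (not necessarily centered) with $\mathbb E\,\mathbf x\mathbf x^T=\Sigma$ and $\|\langle u,\mathbf x\rangle\|_{\psi_2}\le K\,(u^T\Sigma u)^{1/2}$ for all $u\in\mathbb R^d$; for invertible $\Sigma$ the latter says that the isotropic vector $\Sigma^{-1/2}\mathbf x$ has sub-Gaussian norm at most $K$. **Corollary 3.2.** For every $K\ge 0$ there are constants $C_0,C_1,C_2>0$, depending only on $K$, such that the following holds for all $d,n_\xi,n_\upsilon$ and every positive definite $\Sigma\in\mathbb R^{d\times d}$. Let $\xi_1,\dots,\xi_{n_\xi}$ (private data) be identically distributed with a law in $subG_K(\Sigma)$, let $\upsilon_1,\dots,\upsilon_{n_\upsilon}$ (public data) be identically distributed with a law in $subG_K(\Sigma)$, and let all these vectors be independent. Let $\Upsilon\in\mathbb R^{n_\upsilon\times d}$ have rows $\upsilon_j^T$,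 and let $$\hat\Sigma=\tfrac1{n_\upsilon}\Upsilon^T\Upsilon,\qquad \tilde\Sigma=\hat\Sigma^{-1/2}\Sigma\hat\Sigma^{-1/2},\qquad \tilde\xi_i=\hat\Sigma^{-1/2}\xi_i .$$ 1. Conditionally on $\Upsilon$, for almost every value of $\Upsilon$ for which $\hat\Sigma$ is invertible, $\tilde\xi_i\sim subG_K(\tilde\Sigma)$ for every $i$. 2. If $0<\eta<1$ and $\sqrt{n_\upsilon}\ge C_0\big(\sqrt d+\sqrt{\log(1/\eta)}\big)$, then with probability at least $1-3\eta$ the matrix $\hat\Sigma$ is invertible and, for all $i=1,\dots,n_\xi$, $$\|\tilde\xi_i\|_2^2\ \le\ \operatorname{Tr}(\tilde\Sigma)+C_1\,d\log\!\Big(\frac{2n_\xi}{\eta}\Big)\ \le\ C_2\,d\Big(1+\log\!\Big(\frac{2n_\xi}{\eta}\Big)\Big).$$ -/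

import Mathlib

open MeasureTheory ProbabilityTheory
open scoped NNReal ENNReal

noncomputable section

/-- The sub-Gaussian norm `inf {t > 0 : 𝔼 exp (X² / t²) ≤ 2}` of a real random variable `X`;
it is `∞` if there is no such `t`. -/
def psiTwoNorm {Ω : Type*} [MeasurableSpace Ω] (X : Ω → ℝ) (μ : Measure Ω) : ℝ≥0∞ :=
  ⨅ (t : ℝ) (_ : 0 < t) (_ : ∫⁻ ω, ENNReal.ofReal (Real.exp (X ω ^ 2 / t ^ 2)) ∂μ ≤ 2),
    ENNReal.ofReal t

/-- The class `subG(S)` with sub-Gaussian constant `K`: probability measures on `ℝᵈ` with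
second-moment matrix `S = 𝔼 x xᵀ` all of whose one-dimensional marginals satisfy
`‖⟨u, x⟩‖_{ψ₂} ≤ K (uᵀ S u)^{1/2}`. For invertible `S` the last condition says that the isotropic
vector `S^{-1/2} x` has sub-Gaussian norm at most `K`, that is
`‖⟨u, S^{-1/2} x⟩‖_{ψ₂} ≤ K` for all unit vectors `u`. The mean need not be zero. -/
structure IsSubG {d : ℕ} (K : ℝ≥0) (S : Matrix (Fin d) (Fin d) ℝ)
    (μ : Measure (EuclideanSpace ℝ (Fin d))) : Prop where
  isProbabilityMeasure : IsProbabilityMeasure μ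
  integrable_mul : ∀ k l, Integrable (fun x => x k * x l) μ
  secondMoment : ∀ k l, ∫ x, x k * x l ∂μ = S k l
  psiTwoNorm_le : ∀ u : EuclideanSpace ℝ (Fin d),
    psiTwoNorm (fun x => inner ℝ u x) μ ≤
      K * ENNReal.ofReal (Real.sqrt (u.ofLp ⬝ᵥ S.mulVec u.ofLp))

/-- The `n × d` data matrix whose rows are the sample points. -/
def dataMatrix {n d : ℕ} (y : Fin n → EuclideanSpace ℝ (Fin d)) : Matrix (Fin n) (Fin d) ℝ :=
  Matrix.of fun j k => y j k

/-- The second-moment estimate `(1/n) Υᵀ Υ`. -/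
def secondMomentEstimate {n d : ℕ} (y : Fin n → EuclideanSpace ℝ (Fin d)) :
    Matrix (Fin d) (Fin d) ℝ :=
  (1 / (n : ℝ)) • ((dataMatrix y).transpose * dataMatrix y)

open scoped MatrixOrder in
/-- `A^{-1/2}`, the positive semidefinite square root of `A⁻¹`
(meaningful for positive definite `A`). -/
def invSqrt {d : ℕ} (A : Matrix (Fin d) (Fin d) ℝ) : Matrix (Fin d) (Fin d) ℝ :=
  CFC.sqrt A⁻¹

/-- The whitened vector `Σ̂^{-1/2} x`, with `Σ̂` the second-moment estimate from the sample `y`. -/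
def whiten {n d : ℕ} (y : Fin n → EuclideanSpace ℝ (Fin d)) (x : EuclideanSpace ℝ (Fin d)) :
    EuclideanSpace ℝ (Fin d) :=
  WithLp.toLp 2 ((invSqrt (secondMomentEstimate y)).mulVec x.ofLp)

/-- The whitened second-moment matrix `Σ̂^{-1/2} S Σ̂^{-1/2}`. -/
def whitenedMoment {n d : ℕ} (y : Fin n → EuclideanSpace ℝ (Fin d))
    (S : Matrix (Fin d) (Fin d) ℝ) : Matrix (Fin d) (Fin d) ℝ :=
  invSqrt (secondMomentEstimate y) * S * invSqrt (secondMomentEstimate y)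

end

/-! Write `L = K + 1`. Everything in the norm bound reduces to the form inequality `S ≤ 5 Σ̂`. It
makes `Σ̂` invertible, it gives `Tr Σ̃ ≤ 5d`, and by order reversal of the inverse `‖Σ̂^{-1/2} x‖² ≤
5 ‖S^{-1/2} x‖²`.

The form inequality fails with probability at most `2η`. For a unit vector `v`, the squares
`⟨S^{-1/2} v, υ_j⟩²` are independent, sub-exponential and of mean 1, so Bernstein
(`measureReal_abs_sum_sub_ge_le`) puts their sum within `n/4` of `n`. A union bound over a 1/4-net
of at most `9^d` points (`exists_quarter_net_sphere`) and approximation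
(`mul_norm_sq_le_of_quarter_net`) extend this to all directions.

The isotropic norms `‖S^{-1/2} ξ_i‖²` are all at most `d L² log(2n/η)` except with probability `η`,
by `IsSubG.measureReal_lt_le` and a union bound. The trace enters the first inequality only as a
nonnegative extra term.

The conditional statement is separate: by independence, conditioning on the public data freezes the
whitening matrix, and `subG_K` is stable under that linear map with the same `K`. -/

/-! ### Exponential moments from the sub-Gaussian norm. -/

theorem lintegral_exp_sq_div_le_of_psiTwoNorm_lt {Ω : Type*} [MeasurableSpace Ω] {X : Ω → ℝ}
    {μ : Measure Ω} {L : ℝ} (h : psiTwoNorm X μ < ENNReal.ofReal L) :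
    ∫⁻ ω, ENNReal.ofReal (Real.exp (X ω ^ 2 / L ^ 2)) ∂μ ≤ 2 := by
  simp only [psiTwoNorm, iInf_lt_iff] at h
  obtain ⟨t, ht, hint, htL⟩ := h
  have htL' : t < L := (ENNReal.ofReal_lt_ofReal_iff_of_nonneg ht.le).1 htL
  refine le_trans (lintegral_mono fun ω => ?_) hint
  gcongr

/-- Enlarging `K` to `K + 1` goes strictly above the infimum, so its attainment is not needed; it
also covers `K = 0` and gives a scale of at least 1. -/
theorem IsSubG.lintegral_exp_inner_sq_le {d : ℕ} {K : ℝ≥0} {S : Matrix (Fin d) (Fin d) ℝ}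
    {ν : Measure (EuclideanSpace ℝ (Fin d))} (h : IsSubG K S ν) {w : EuclideanSpace ℝ (Fin d)}
    (hw : w.ofLp ⬝ᵥ S.mulVec w.ofLp = 1) :
    ∫⁻ x, ENNReal.ofReal (Real.exp (inner ℝ w x ^ 2 / ((K : ℝ) + 1) ^ 2)) ∂ν ≤ 2 := by
  apply lintegral_exp_sq_div_le_of_psiTwoNorm_lt
  refine (h.psiTwoNorm_le w).trans_lt ?_
  rw [hw, Real.sqrt_one, ENNReal.ofReal_one, mul_one, ← ENNReal.ofReal_coe_nnreal]
  exact (ENNReal.ofReal_lt_ofReal_iff (by positivity)).2 (by linarith)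

/-- The second-order Taylor remainder is at most `(l y)² exp |l y|`. One factor `exp (y / 2)`
absorbs `y²`, the other dominates `exp |l y|`. -/
theorem exp_mul_le_one_add_mul_add {y l : ℝ} (hy : 0 ≤ y) (hl : |l| ≤ 1 / 2) :
    Real.exp (l * y) ≤ 1 + l * y + 8 * l ^ 2 * Real.exp y := by
  have h1 : Real.exp (l * y) - (1 + l * y) ≤ |l * y| ^ 2 * Real.exp |l * y| := by
    have := Complex.norm_exp_sub_sum_le_norm_mul_exp ((l * y : ℝ) : ℂ) 2
    simp only [Finset.sum_range_succ, Finset.sum_range_zero] at this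
    norm_num at this
    rw [← abs_mul] at this
    refine le_trans (le_abs_self _) ?_
    rw [← Real.norm_eq_abs, ← Complex.norm_real]
    push_cast
    simpa using this
  have h2 : Real.exp |l * y| ≤ Real.exp (y / 2) := by
    rw [Real.exp_le_exp, abs_mul, abs_of_nonneg hy]
    nlinarith
  have h3 : y ^ 2 ≤ 8 * Real.exp (y / 2) := by
    have := Real.quadratic_le_exp_of_nonneg (x := y / 2) (by positivity)
    nlinarith
  have h4 : Real.exp y = Real.exp (y / 2) * Real.exp (y / 2) := by
    rw [← Real.exp_add]; ring_nf
  have h5 : |l * y| ^ 2 * Real.exp |l * y| ≤ l ^ 2 * (8 * Real.exp (y / 2)) * Real.exp (y / 2) := by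
    rw [sq_abs, mul_pow]
    gcongr
  rw [h4]
  linarith

/-! ### Bernstein's inequality from one exponential moment. -/

section Bernstein

variable {Ω : Type*} [MeasurableSpace Ω] {μ : Measure Ω} {Y : Ω → ℝ}

theorem integrable_exp_of_lintegral_exp_le_two (hY : AEMeasurable Y μ)
    (h : ∫⁻ ω, ENNReal.ofReal (Real.exp (Y ω)) ∂μ ≤ 2) :
    Integrable (fun ω => Real.exp (Y ω)) μ := by
  refine ⟨hY.exp.aestronglyMeasurable, ?_⟩
  rw [hasFiniteIntegral_iff_ofReal (ae_of_all _ fun _ => (Real.exp_pos _).le)]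
  exact h.trans_lt (by simp)

theorem integrable_exp_mul_of_lintegral_exp_le_two (hY : AEMeasurable Y μ) (h0 : ∀ ω, 0 ≤ Y ω)
    (h : ∫⁻ ω, ENNReal.ofReal (Real.exp (Y ω)) ∂μ ≤ 2) {l : ℝ} (hl : l ≤ 1) :
    Integrable (fun ω => Real.exp (l * Y ω)) μ := by
  refine (integrable_exp_of_lintegral_exp_le_two hY h).mono'
    (hY.const_mul l).exp.aestronglyMeasurable (ae_of_all _ fun ω => ?_)
  rw [Real.norm_eq_abs, Real.abs_exp, Real.exp_le_exp]
  nlinarith [h0 ω]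

theorem integrable_of_lintegral_exp_le_two (hY : AEMeasurable Y μ) (h0 : ∀ ω, 0 ≤ Y ω)
    (h : ∫⁻ ω, ENNReal.ofReal (Real.exp (Y ω)) ∂μ ≤ 2) : Integrable Y μ := by
  refine (integrable_exp_of_lintegral_exp_le_two hY h).mono' hY.aestronglyMeasurable
    (ae_of_all _ fun ω => ?_)
  rw [Real.norm_eq_abs, abs_of_nonneg (h0 ω)]
  linarith [Real.add_one_le_exp (Y ω)]

theorem mgf_le_exp_of_lintegral_exp_le_two [IsProbabilityMeasure μ] (hY : AEMeasurable Y μ)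
    (h0 : ∀ ω, 0 ≤ Y ω) (h : ∫⁻ ω, ENNReal.ofReal (Real.exp (Y ω)) ∂μ ≤ 2) {l : ℝ}
    (hl : |l| ≤ 1 / 2) :
    mgf Y μ l ≤ Real.exp (l * ∫ ω, Y ω ∂μ + 16 * l ^ 2) := by
  have hi1 := integrable_exp_of_lintegral_exp_le_two hY h
  have hi2 := integrable_of_lintegral_exp_le_two hY h0 h
  have h2 : ∫ ω, Real.exp (Y ω) ∂μ ≤ 2 := by
    rw [integral_eq_lintegral_of_nonneg_ae (ae_of_all _ fun _ => (Real.exp_pos _).le)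
      hi1.aestronglyMeasurable]
    exact ENNReal.toReal_le_of_le_ofReal (by norm_num) (by simpa using h)
  have h3 : mgf Y μ l ≤ ∫ ω, (1 + l * Y ω + 8 * l ^ 2 * Real.exp (Y ω)) ∂μ := by
    refine integral_mono (integrable_exp_mul_of_lintegral_exp_le_two hY h0 h ?_)
      (((integrable_const 1).add (hi2.const_mul l)).add (hi1.const_mul _))
      fun ω => exp_mul_le_one_add_mul_add (h0 ω) hl
    linarith [le_abs_self l]
  have h4 : ∫ ω, (1 + l * Y ω + 8 * l ^ 2 * Real.exp (Y ω)) ∂μ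
      = 1 + l * ∫ ω, Y ω ∂μ + 8 * l ^ 2 * ∫ ω, Real.exp (Y ω) ∂μ := by
    have e1 := integral_add ((integrable_const (1 : ℝ)).add (hi2.const_mul l))
      (hi1.const_mul (8 * l ^ 2))
    have e2 := integral_add (integrable_const (μ := μ) (1 : ℝ)) (hi2.const_mul l)
    simp only [Pi.add_apply] at e1 e2
    rw [e1, e2, integral_const_mul, integral_const_mul]
    simp
  rw [h4] at h3
  -- The exponential moment is at most 2, so the quadratic term is at most `16 l²`; then `1 + z ≤
  -- exp z`.
  nlinarith [Real.add_one_le_exp (l * ∫ ω, Y ω ∂μ + 16 * l ^ 2), sq_nonneg l]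

theorem integrable_exp_mul_sum_of_aemeasurable [IsFiniteMeasure μ] {ι : Type*} {Y : ι → Ω → ℝ}
    {l : ℝ} (hind : iIndepFun Y μ) (hY : ∀ i, AEMeasurable (Y i) μ)
    (hint : ∀ i, Integrable (fun ω => Real.exp (l * Y i ω)) μ) (s : Finset ι) :
    Integrable (fun ω => Real.exp (l * (∑ i ∈ s, Y i) ω)) μ := by
  classical
  induction s using Finset.induction_on with
  | empty => simp
  | insert i s hi ih =>
    rw [Finset.sum_insert hi]
    exact IndepFun.integrable_exp_mul_add (hind.indepFun_finsetSum_of_notMem₀ hY hi).symm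
      (hint i) ih

/-- Two-sided Bernstein inequality for nonnegative sub-exponential variables. -/
theorem measureReal_abs_sum_sub_ge_le [IsProbabilityMeasure μ] {n : ℕ} {Y : Fin n → Ω → ℝ}
    (hY : ∀ j, AEMeasurable (Y j) μ) (h0 : ∀ j ω, 0 ≤ Y j ω)
    (h : ∀ j, ∫⁻ ω, ENNReal.ofReal (Real.exp (Y j ω)) ∂μ ≤ 2) (hind : iIndepFun Y μ) {m t : ℝ}
    (hm : ∀ j, ∫ ω, Y j ω ∂μ = m) (ht : 0 ≤ t) (ht' : t ≤ 16) :
    μ.real {ω | n * t ≤ |∑ j, Y j ω - n * m|} ≤ 2 * Real.exp (-(n * t ^ 2 / 64)) := by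
  have hmgf : ∀ l : ℝ, |l| ≤ 1 / 2 →
      mgf (∑ j, Y j) μ l ≤ Real.exp (n * (l * m + 16 * l ^ 2)) := by
    intro l hl
    rw [hind.mgf_sum₀ hY, Real.exp_nat_mul]
    calc _ ≤ ∏ _j : Fin n, Real.exp (l * m + 16 * l ^ 2) :=
          Finset.prod_le_prod (fun _ _ => mgf_nonneg) fun j _ => by
            rw [← hm j]; exact mgf_le_exp_of_lintegral_exp_le_two (hY j) (h0 j) (h j) hl
      _ = _ := by simp
  have hint : ∀ l : ℝ, |l| ≤ 1 / 2 → Integrable (fun ω => Real.exp (l * (∑ j, Y j) ω)) μ := by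
    intro l hl
    exact integrable_exp_mul_sum_of_aemeasurable hind hY (fun j =>
      integrable_exp_mul_of_lintegral_exp_le_two (hY j) (h0 j) (h j)
        (by linarith [le_abs_self l])) _
  -- `l = t / 32` minimises `-l t + 16 l²`, with value `-t² / 64`; `t ≤ 16` keeps `l` in the
  -- admissible range.
  have hl1 : |t / 32| ≤ 1 / 2 := by rw [abs_of_nonneg (by positivity)]; linarith
  have hl2 : |-(t / 32)| ≤ 1 / 2 := by rwa [abs_neg]
  have hup : μ.real {ω | n * (m + t) ≤ (∑ j, Y j) ω} ≤ Real.exp (-(n * t ^ 2 / 64)) := by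
    refine (measure_ge_le_exp_mul_mgf _ (by positivity) (hint _ hl1)).trans ?_
    refine (mul_le_mul_of_nonneg_left (hmgf _ hl1) (Real.exp_pos _).le).trans ?_
    rw [← Real.exp_add, Real.exp_le_exp]
    exact le_of_eq (by ring)
  have hlo : μ.real {ω | (∑ j, Y j) ω ≤ n * (m - t)} ≤ Real.exp (-(n * t ^ 2 / 64)) := by
    refine (measure_le_le_exp_mul_mgf _ (by linarith) (hint _ hl2)).trans ?_
    refine (mul_le_mul_of_nonneg_left (hmgf _ hl2) (Real.exp_pos _).le).trans ?_
    rw [← Real.exp_add, Real.exp_le_exp]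
    exact le_of_eq (by ring)
  have hsub : {ω | n * t ≤ |∑ j, Y j ω - n * m|} ⊆
      {ω | n * (m + t) ≤ (∑ j, Y j) ω} ∪ {ω | (∑ j, Y j) ω ≤ n * (m - t)} := by
    intro ω hω
    simp only [Set.mem_ofPred_eq, Set.mem_union, Finset.sum_apply] at hω ⊢
    rcases le_abs.1 hω with h | h
    · left; linarith
    · right; linarith
  calc _ ≤ _ := measureReal_mono hsub
    _ ≤ _ := measureReal_union_le _ _
    _ ≤ _ := by linarith

end Bernstein

/-! ### Nets of the sphere. -/

section Net

variable {E F : Type*} [NormedAddCommGroup E] [NormedSpace ℝ E]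
  [NormedAddCommGroup F] [NormedSpace ℝ F]

open Metric Module in
-- Volume comparison: the balls of radius 1/8 about the points are disjoint and lie in the ball of
-- radius 9/8.
theorem card_le_nine_pow_of_separated [FiniteDimensional ℝ E] (s : Finset E) (hs : ∀ c ∈ s, ‖c‖ ≤ 1)
    (h : ∀ c ∈ s, ∀ d ∈ s, c ≠ d → 1 / 4 ≤ ‖c - d‖) : s.card ≤ 9 ^ finrank ℝ E := by
  borelize E
  let μ : Measure E := Measure.addHaar
  have hD : (s : Set E).PairwiseDisjoint fun c => ball (c : E) (1 / 8) := by
    rintro c hc d hd hcd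
    apply ball_disjoint_ball
    rw [dist_eq_norm]
    exact le_trans (by norm_num) (h c hc d hd hcd)
  have hsub : (⋃ c ∈ s, ball (c : E) (1 / 8)) ⊆ ball (0 : E) (9 / 8) := by
    refine Set.iUnion₂_subset fun x hx => ball_subset_ball' ?_
    rw [dist_zero_right]
    linarith [hs x hx]
  have hvol : (s.card : ℝ≥0∞) * ENNReal.ofReal ((1 / 8) ^ finrank ℝ E) * μ (ball 0 1) ≤
      ENNReal.ofReal ((9 / 8) ^ finrank ℝ E) * μ (ball 0 1) := by
    calc _ = μ (⋃ c ∈ s, ball (c : E) (1 / 8)) := by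
          rw [measure_biUnion_finset hD fun c _ => measurableSet_ball]
          simp only [μ.addHaar_ball_of_pos _ (show (0 : ℝ) < 1 / 8 by norm_num), Finset.sum_const,
            nsmul_eq_mul, mul_assoc]
      _ ≤ μ (ball (0 : E) (9 / 8)) := measure_mono hsub
      _ = _ := μ.addHaar_ball_of_pos _ (by norm_num)
  have hcard := (ENNReal.mul_le_mul_iff_left (measure_ball_pos _ _ zero_lt_one).ne'
    measure_ball_lt_top.ne).1 hvol
  have hreal : (s.card : ℝ) ≤ (9 : ℝ) ^ finrank ℝ E := by
    have := ENNReal.toReal_le_of_le_ofReal (by positivity) hcard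
    rw [ENNReal.toReal_mul, ENNReal.toReal_natCast, ENNReal.toReal_ofReal (by positivity),
      div_pow, div_pow, one_pow, mul_one_div] at this
    exact (div_le_div_iff_of_pos_right (by positivity)).1 this
  exact_mod_cast hreal

open Module in
-- A 1/4-separated subset of the sphere of maximal cardinality is a net; the volume bound makes the
-- maximum exist.
theorem exists_quarter_net_sphere (E : Type*) [NormedAddCommGroup E] [NormedSpace ℝ E]
    [FiniteDimensional ℝ E] :
    ∃ N : Finset E, N.card ≤ 9 ^ finrank ℝ E ∧ (∀ v ∈ N, ‖v‖ = 1) ∧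
      ∀ u : E, ‖u‖ = 1 → ∃ v ∈ N, ‖u - v‖ ≤ 1 / 4 := by
  classical
  let p : ℕ → Prop := fun k => ∃ N : Finset E, N.card = k ∧ (∀ v ∈ N, ‖v‖ = 1) ∧
    ∀ c ∈ N, ∀ d ∈ N, c ≠ d → 1 / 4 ≤ ‖c - d‖
  have hp : ∀ k, p k → k ≤ 9 ^ finrank ℝ E := by
    rintro _ ⟨N, rfl, h1, h2⟩
    exact card_le_nine_pow_of_separated N (fun c hc => (h1 c hc).le) h2
  have hp0 : p 0 := ⟨∅, by simp⟩
  obtain ⟨N, hN, h1, h2⟩ := Nat.findGreatest_spec (P := p) (Nat.zero_le (9 ^ finrank ℝ E)) hp0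
  refine ⟨N, hp _ ⟨N, rfl, h1, h2⟩, h1, fun u hu => ?_⟩
  by_contra! hcon
  have huN : u ∉ N := fun hmem => by
    have := hcon u hmem
    norm_num at this
  have hpu : p (N.card + 1) := by
    refine ⟨insert u N, Finset.card_insert_of_notMem huN, ?_, ?_⟩
    · intro v hv
      rcases Finset.mem_insert.1 hv with rfl | hv
      exacts [hu, h1 v hv]
    · intro c hc e he hce
      rcases Finset.mem_insert.1 hc with rfl | hc' <;> rcases Finset.mem_insert.1 he with rfl | he'
      · exact absurd rfl hce
      · exact (hcon e he').le
      · rw [norm_sub_rev]; exact (hcon c hc').le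
      · exact h2 c hc' e he' hce
  have := Nat.le_findGreatest (hp _ hpu) hpu
  omega

/-- Near-isometry of a linear map on a `1/4`-net of the sphere bounds it below everywhere. -/
theorem mul_norm_sq_le_of_quarter_net (A : E →L[ℝ] F) {N : Finset E}
    (hN : ∀ u : E, ‖u‖ = 1 → ∃ v ∈ N, ‖u - v‖ ≤ 1 / 4) {c : ℝ} (hc : 0 ≤ c)
    (hlo : ∀ v ∈ N, 3 / 4 * c ≤ ‖A v‖ ^ 2) (hup : ∀ v ∈ N, ‖A v‖ ^ 2 ≤ 5 / 4 * c) (u : E) :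
    c * ‖u‖ ^ 2 ≤ 5 * ‖A u‖ ^ 2 := by
  obtain ⟨r, hr, rfl⟩ : ∃ r : ℝ, 0 ≤ r ∧ c = r ^ 2 := ⟨√c, by positivity, (Real.sq_sqrt hc).symm⟩
  have hup' : ∀ v ∈ N, ‖A v‖ ≤ 1.12 * r := fun v hv =>
    abs_le_of_sq_le_sq' (by nlinarith [hup v hv, sq_nonneg r]) (by positivity) |>.2
  have hlo' : ∀ v ∈ N, 0.86 * r ≤ ‖A v‖ := fun v hv =>
    abs_le_of_sq_le_sq' (by nlinarith [hlo v hv, sq_nonneg r]) (by positivity) |>.2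
  have hdiff : ∀ u v : E, ‖u - v‖ ≤ 1 / 4 → ‖A u - A v‖ ≤ ‖A‖ / 4 := by
    intro u v huv
    rw [← map_sub]
    exact (A.le_opNorm _).trans (by nlinarith [norm_nonneg A])
  -- Self-bounding: this yields `‖A‖ / 4 ≤ 0.374 r`, so at least `0.86 r - 0.374 r ≥ 0.48 r`
  -- survives on the sphere, and `5 * 0.48² ≥ 1`.
  have hA : ‖A‖ ≤ 1.12 * r + ‖A‖ / 4 := by
    refine A.opNorm_le_of_unit_norm (by positivity) fun u hu => ?_
    obtain ⟨v, hv, huv⟩ := hN u hu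
    linarith [hdiff u v huv, hup' v hv, norm_sub_norm_le (A u) (A v)]
  have hunit : ∀ u : E, ‖u‖ = 1 → r ^ 2 ≤ 5 * ‖A u‖ ^ 2 := by
    intro u hu
    obtain ⟨v, hv, huv⟩ := hN u hu
    have h1 := hdiff u v huv
    have h2 := norm_sub_norm_le (A v) (A u)
    rw [norm_sub_rev] at h2
    have : 0.48 * r ≤ ‖A u‖ := by linarith [hlo' v hv]
    nlinarith
  rcases eq_or_ne u 0 with rfl | hu
  · simp
  have hu' : 0 < ‖u‖ := norm_pos_iff.2 hu
  have h := hunit (‖u‖⁻¹ • u) (by rw [norm_smul, norm_inv, norm_norm, inv_mul_cancel₀ hu'.ne'])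
  rw [map_smul, norm_smul, norm_inv, norm_norm, mul_pow, inv_pow] at h
  have h' := mul_le_mul_of_nonneg_right h (sq_nonneg ‖u‖)
  calc _ ≤ _ := h'
    _ = _ := by field_simp

end Net

/-! ### Inverse square roots and the form order. -/

section InvSqrt

variable {d : ℕ}

open scoped MatrixOrder in
theorem invSqrt_posSemidef (M : Matrix (Fin d) (Fin d) ℝ) : (invSqrt M).PosSemidef :=
  Matrix.nonneg_iff_posSemidef.1 (CFC.sqrt_nonneg _)

theorem transpose_invSqrt (M : Matrix (Fin d) (Fin d) ℝ) : (invSqrt M).transpose = invSqrt M := by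
  simpa [Matrix.IsHermitian] using (invSqrt_posSemidef M).isHermitian

open scoped MatrixOrder in
theorem invSqrt_mul_invSqrt {M : Matrix (Fin d) (Fin d) ℝ} (hM : M.PosSemidef) :
    invSqrt M * invSqrt M = M⁻¹ :=
  CFC.sqrt_mul_sqrt_self _ (Matrix.nonneg_iff_posSemidef.2 hM.inv)

theorem mul_invSqrt_mul_invSqrt {M : Matrix (Fin d) (Fin d) ℝ} (hM : M.PosDef) :
    M * (invSqrt M * invSqrt M) = 1 := by
  rw [invSqrt_mul_invSqrt hM.posSemidef, Matrix.mul_nonsing_inv _ (M.isUnit_iff_isUnit_det.1 hM.isUnit)]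

theorem invSqrt_mul_mul_invSqrt {M : Matrix (Fin d) (Fin d) ℝ} (hM : M.PosDef) :
    invSqrt M * M * invSqrt M = 1 := by
  have h := mul_invSqrt_mul_invSqrt hM
  rw [← Matrix.mul_assoc] at h
  rw [Matrix.mul_assoc]
  exact mul_eq_one_comm.1 h

open Matrix

theorem invSqrt_mulVec_dotProduct (M : Matrix (Fin d) (Fin d) ℝ) (x y : Fin d → ℝ) :
    (invSqrt M *ᵥ x) ⬝ᵥ y = x ⬝ᵥ (invSqrt M *ᵥ y) := by
  rw [dotProduct_mulVec, ← mulVec_transpose, transpose_invSqrt]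

theorem dotProduct_sq_le (x y : Fin d → ℝ) : (x ⬝ᵥ y) ^ 2 ≤ (x ⬝ᵥ x) * (y ⬝ᵥ y) := by
  simpa [dotProduct, sq] using Finset.sum_mul_sq_le_sq_mul_sq Finset.univ x y

variable {S M : Matrix (Fin d) (Fin d) ℝ} {c : ℝ}

/-- If `S ≤ c M` as quadratic forms then `M⁻¹ ≤ c S⁻¹`. -/
theorem dotProduct_invSqrt_mulVec_le (hc : 0 ≤ c) (hS : S.PosDef) (hM : M.PosDef)
    (h : ∀ u, u ⬝ᵥ S *ᵥ u ≤ c * (u ⬝ᵥ M *ᵥ u)) (x : Fin d → ℝ) :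
    (invSqrt M *ᵥ x) ⬝ᵥ (invSqrt M *ᵥ x) ≤ c * ((invSqrt S *ᵥ x) ⬝ᵥ (invSqrt S *ᵥ x)) := by
  set y := invSqrt M *ᵥ x with hy
  set w := invSqrt M *ᵥ y with hw
  have hST : S.transpose = S := by simpa [Matrix.IsHermitian] using hS.isHermitian
  have hsym : ∀ a b, (S *ᵥ a) ⬝ᵥ b = a ⬝ᵥ S *ᵥ b := fun a b => by
    rw [dotProduct_mulVec, ← mulVec_transpose, hST]
  have hSTT : ∀ z, S *ᵥ (invSqrt S *ᵥ (invSqrt S *ᵥ z)) = z := fun z => by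
    rw [mulVec_mulVec, mulVec_mulVec, Matrix.mul_assoc, mul_invSqrt_mul_invSqrt hS, one_mulVec]
  -- Here `w = M⁻¹ x`, and `S^{-1/2} S` plays the role of `S^{1/2}`. Cauchy–Schwarz gives `(y·y)² ≤
  -- (w·Sw) ‖S^{-1/2} x‖²`, while `w·Sw ≤ c (w·Mw) = c (y·y)`; one factor `y·y` cancels.
  have h1 : y ⬝ᵥ y = (invSqrt S *ᵥ (S *ᵥ w)) ⬝ᵥ (invSqrt S *ᵥ x) := by
    rw [invSqrt_mulVec_dotProduct S, hsym, hSTT, dotProduct_comm w, hw,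
      ← invSqrt_mulVec_dotProduct]
    exact dotProduct_comm _ _
  have h2 : (invSqrt S *ᵥ (S *ᵥ w)) ⬝ᵥ (invSqrt S *ᵥ (S *ᵥ w)) = w ⬝ᵥ S *ᵥ w := by
    rw [invSqrt_mulVec_dotProduct, hsym, hSTT]
  have h3 : w ⬝ᵥ M *ᵥ w = y ⬝ᵥ y := by
    rw [hw, invSqrt_mulVec_dotProduct, mulVec_mulVec, mulVec_mulVec,
      invSqrt_mul_mul_invSqrt hM, one_mulVec]
  have h4 := dotProduct_sq_le (invSqrt S *ᵥ (S *ᵥ w)) (invSqrt S *ᵥ x)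
  rw [← h1, h2] at h4
  have h5 := h w
  rw [h3] at h5
  have hT : 0 ≤ (invSqrt S *ᵥ x) ⬝ᵥ (invSqrt S *ᵥ x) := by
    simpa using dotProduct_star_self_nonneg (invSqrt S *ᵥ x)
  have hy0 : 0 ≤ y ⬝ᵥ y := by simpa using dotProduct_star_self_nonneg y
  rcases hy0.eq_or_lt with h0 | hpos
  · rw [← h0]
    positivity
  · nlinarith

/-- Conjugating `c M - S ≥ 0` by `M^{-1/2}` gives `c I - M^{-1/2} S M^{-1/2} ≥ 0`. -/
theorem trace_invSqrt_mul_mul_invSqrt_le (hM : M.PosDef) (hS : S.PosDef)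
    (h : ∀ u, u ⬝ᵥ S *ᵥ u ≤ c * (u ⬝ᵥ M *ᵥ u)) :
    (invSqrt M * S * invSqrt M).trace ≤ c * d := by
  have hpsd : (c • M - S).PosSemidef := by
    refine PosSemidef.of_dotProduct_mulVec_nonneg ?_ fun u => ?_
    · exact (hM.isHermitian.smul (by simp [IsSelfAdjoint])).sub hS.isHermitian
    · have := h u
      simp only [star_trivial, sub_mulVec, dotProduct_sub, smul_mulVec, dotProduct_smul,
        smul_eq_mul]
      linarith
  have := (hpsd.mul_mul_conjTranspose_same (invSqrt M)).trace_nonneg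
  rw [conjTranspose_eq_transpose_of_trivial, transpose_invSqrt, Matrix.mul_sub, Matrix.sub_mul,
    Matrix.mul_smul, Matrix.smul_mul, invSqrt_mul_mul_invSqrt hM, trace_sub, trace_smul,
    trace_one] at this
  simp at this
  linarith

theorem trace_invSqrt_mul_mul_invSqrt_nonneg (hS : S.PosDef) :
    0 ≤ (invSqrt M * S * invSqrt M).trace := by
  have := (hS.posSemidef.mul_mul_conjTranspose_same (invSqrt M)).trace_nonneg
  rwa [conjTranspose_eq_transpose_of_trivial, transpose_invSqrt] at this

end InvSqrt

/-! ### The empirical second moment and measurability of whitening. -/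

section Estimate

open Matrix

variable {n d : ℕ}

theorem posSemidef_secondMomentEstimate (y : Fin n → EuclideanSpace ℝ (Fin d)) :
    (secondMomentEstimate y).PosSemidef := by
  refine PosSemidef.smul ?_ (by positivity)
  simpa using posSemidef_conjTranspose_mul_self (dataMatrix y)

theorem dotProduct_secondMomentEstimate_mulVec (y : Fin n → EuclideanSpace ℝ (Fin d))
    (u : Fin d → ℝ) :
    u ⬝ᵥ secondMomentEstimate y *ᵥ u = 1 / n * ∑ j, ((y j).ofLp ⬝ᵥ u) ^ 2 := by
  rw [secondMomentEstimate, smul_mulVec, dotProduct_smul, ← mulVec_mulVec, dotProduct_mulVec,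
    vecMul_transpose, smul_eq_mul]
  congr 1
  exact Finset.sum_congr rfl fun j _ => (sq _).symm

open scoped MatrixOrder Matrix.Norms.L2Operator in
theorem continuous_sqrt_subtype :
    Continuous fun M : {M : Matrix (Fin d) (Fin d) ℝ // 0 ≤ M} => CFC.sqrt M.1 := by
  simp_rw [CFC.sqrt_eq_cfc]
  exact Continuous.cfc_nnreal_of_mem_nhdsSet (s := Set.univ) NNReal.sqrt (by simp)
    continuous_subtype_val (fun x => x.2) NNReal.continuous_sqrt.continuousOn

open scoped MatrixOrder in
-- The inverse is measurable through determinant and adjugate, and positive semidefinite even at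
-- singular matrices, where it is 0 by convention. So it always lands in the cone on which the
-- square root is continuous.
theorem measurable_invSqrt_secondMomentEstimate (k l : Fin d) :
    Measurable fun y : Fin n → EuclideanSpace ℝ (Fin d) =>
      invSqrt (secondMomentEstimate y) k l := by
  borelize (Matrix (Fin d) (Fin d) ℝ)
  have : SecondCountableTopology (Matrix (Fin d) (Fin d) ℝ) :=
    inferInstanceAs (SecondCountableTopology (Fin d → Fin d → ℝ))
  have h1 : Measurable fun y : Fin n → EuclideanSpace ℝ (Fin d) => (secondMomentEstimate y)⁻¹ := by
    have hc : Continuous fun y : Fin n → EuclideanSpace ℝ (Fin d) => secondMomentEstimate y := by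
      unfold secondMomentEstimate dataMatrix
      fun_prop
    simp_rw [Matrix.inv_def, Ring.inverse_eq_inv']
    exact hc.matrix_det.measurable.inv.smul hc.matrix_adjugate.measurable
  have h2 : Continuous fun M : {M : Matrix (Fin d) (Fin d) ℝ // 0 ≤ M} => CFC.sqrt M.1 k l :=
    continuous_sqrt_subtype.matrix_elem k l
  exact h2.measurable.comp
    (h1.subtype_mk (h := fun y => nonneg_iff_posSemidef.2 (posSemidef_secondMomentEstimate y).inv))

theorem measurable_whiten :
    Measurable fun p : (Fin n → EuclideanSpace ℝ (Fin d)) × EuclideanSpace ℝ (Fin d) =>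
      whiten p.1 p.2 := by
  refine (PiLp.continuous_toLp 2 _).measurable.comp (measurable_pi_iff.2 fun k => ?_)
  simp only [mulVec, dotProduct]
  refine Finset.measurable_sum _ fun l _ => Measurable.mul ?_ ?_
  · exact (measurable_invSqrt_secondMomentEstimate k l).comp measurable_fst
  · fun_prop

end Estimate

/-! ### Conditional law of a whitened vector. -/

section Whiten

open Matrix

variable {d n : ℕ} {K : ℝ≥0} {S : Matrix (Fin d) (Fin d) ℝ}
  {ν : Measure (EuclideanSpace ℝ (Fin d))}

theorem inner_eq_dotProduct (u x : EuclideanSpace ℝ (Fin d)) :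
    inner ℝ u x = x.ofLp ⬝ᵥ u.ofLp := by
  simp [EuclideanSpace.inner_eq_star_dotProduct]

theorem inner_whiten (y : Fin n → EuclideanSpace ℝ (Fin d)) (u x : EuclideanSpace ℝ (Fin d)) :
    inner ℝ u (whiten y x) = inner ℝ (whiten y u) x := by
  simp only [inner_eq_dotProduct, whiten, invSqrt_mulVec_dotProduct]

theorem measurable_whiten_right (y : Fin n → EuclideanSpace ℝ (Fin d)) : Measurable (whiten y) := by
  have h := measurable_whiten.comp (measurable_const (a := y) |>.prodMk measurable_id)
  exact h

theorem psiTwoNorm_map {Ω Ω' : Type*} [MeasurableSpace Ω] [MeasurableSpace Ω'] {μ : Measure Ω}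
    {f : Ω → Ω'} (hf : Measurable f) {X : Ω' → ℝ} (hX : Measurable X) :
    psiTwoNorm X (μ.map f) = psiTwoNorm (fun ω => X (f ω)) μ := by
  unfold psiTwoNorm
  congr! 6 with t ht
  rw [lintegral_map (by fun_prop) hf]

/-- Whitening is a symmetric linear map, so it moves onto `u` in every marginal; invertibility plays
no role and `K` is not degraded. -/
theorem IsSubG.map_whiten (h : IsSubG K S ν) (y : Fin n → EuclideanSpace ℝ (Fin d)) :
    IsSubG K (whitenedMoment y S) (ν.map (whiten y)) := by
  have := h.isProbabilityMeasure
  have hm := measurable_whiten_right y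
  have hprod : ∀ k l x, whiten y x k * whiten y x l =
      ∑ a, ∑ b, invSqrt (secondMomentEstimate y) k a * invSqrt (secondMomentEstimate y) l b *
        (x a * x b) := by
    intro k l x
    simp only [whiten, mulVec, dotProduct, Finset.sum_mul_sum]
    exact Finset.sum_congr rfl fun a _ => Finset.sum_congr rfl fun b _ => by ring
  have hint : ∀ k l a b, Integrable (fun x : EuclideanSpace ℝ (Fin d) =>
      invSqrt (secondMomentEstimate y) k a * invSqrt (secondMomentEstimate y) l b *
        (x a * x b)) ν := fun k l a b => (h.integrable_mul a b).const_mul _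
  refine ⟨Measure.isProbabilityMeasure_map hm.aemeasurable, fun k l => ?_, fun k l => ?_,
    fun u => ?_⟩
  · rw [integrable_map_measure (by fun_prop) hm.aemeasurable]
    simp only [Function.comp_def, hprod]
    exact integrable_finsetSum _ fun a _ => integrable_finsetSum _ fun b _ => hint k l a b
  · rw [integral_map hm.aemeasurable (by fun_prop)]
    simp only [hprod]
    rw [integral_finsetSum _ fun a _ => integrable_finsetSum _ fun b _ => hint k l a b]
    simp_rw [integral_finsetSum _ fun b _ => hint k l _ b, integral_const_mul, h.secondMoment]
    simp only [whitenedMoment, mul_apply, Finset.sum_mul]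
    rw [Finset.sum_comm]
    refine Finset.sum_congr rfl fun b _ => Finset.sum_congr rfl fun a _ => ?_
    rw [← congrFun (congrFun (transpose_invSqrt (secondMomentEstimate y)) b) l, transpose_apply]
    ring
  · rw [psiTwoNorm_map hm (by fun_prop)]
    simp_rw [inner_whiten]
    refine (h.psiTwoNorm_le (whiten y u)).trans_eq ?_
    congr 3
    simp only [whiten, whitenedMoment]
    rw [invSqrt_mulVec_dotProduct, mulVec_mulVec, mulVec_mulVec, Matrix.mul_assoc]

/-- Independence makes the joint law a product, which disintegrates along the kernel `y ↦ ν.map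
(whiten y)`; disintegrations are almost everywhere unique. -/
theorem condDistrib_whiten_ae_eq {Ω : Type*} [MeasurableSpace Ω] {P : Measure Ω}
    [IsProbabilityMeasure P] [IsProbabilityMeasure ν] {ξ : Ω → EuclideanSpace ℝ (Fin d)}
    {υ : Ω → Fin n → EuclideanSpace ℝ (Fin d)} (hξ : HasLaw ξ ν P) (hυ : AEMeasurable υ P)
    (hind : IndepFun υ ξ P) :
    ∀ᵐ y ∂(P.map υ), condDistrib (fun ω => whiten (υ ω) (ξ ω)) υ P y = ν.map (whiten y) := by
  have hξm := hξ.aemeasurable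
  have hpair : AEMeasurable (fun ω => (υ ω, ξ ω)) P := hυ.prodMk hξm
  let κ : Kernel (Fin n → EuclideanSpace ℝ (Fin d)) (EuclideanSpace ℝ (Fin d)) :=
    Kernel.map (Kernel.id ×ₖ Kernel.const _ ν) (fun p => whiten p.1 p.2)
  have hκ : ∀ y, κ y = ν.map (whiten y) := by
    intro y
    rw [Kernel.map_apply _ measurable_whiten, Kernel.prod_apply, Kernel.id_apply,
      Kernel.const_apply, Measure.dirac_prod, Measure.map_map measurable_whiten
      measurable_prodMk_left]
    rfl
  have : IsMarkovKernel κ := Kernel.IsMarkovKernel.map _ measurable_whiten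
  have : IsProbabilityMeasure (P.map υ) := Measure.isProbabilityMeasure_map hυ
  have hjoint : P.map (fun ω => (υ ω, ξ ω)) = (P.map υ).prod ν := by
    rw [(indepFun_iff_map_prod_eq_prod_map_map hυ hξm).1 hind, hξ.map_eq]
  have hg : Measurable fun p : (Fin n → EuclideanSpace ℝ (Fin d)) × EuclideanSpace ℝ (Fin d) =>
      (p.1, whiten p.1 p.2) := measurable_fst.prodMk measurable_whiten
  have hcomp : P.map (fun ω => (υ ω, whiten (υ ω) (ξ ω))) = (P.map υ) ⊗ₘ κ := by
    have h1 : P.map (fun ω => (υ ω, whiten (υ ω) (ξ ω))) =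
        ((P.map υ).prod ν).map fun p => (p.1, whiten p.1 p.2) := by
      rw [← hjoint, AEMeasurable.map_map_of_aemeasurable hg.aemeasurable hpair]
      rfl
    rw [h1]
    ext s hs
    rw [Measure.map_apply hg hs, Measure.prod_apply (hg hs), Measure.compProd_apply hs]
    refine lintegral_congr fun y => ?_
    rw [hκ, Measure.map_apply (measurable_whiten_right y) (measurable_prodMk_left hs)]
    rfl
  filter_upwards [condDistrib_ae_eq_of_measure_eq_compProd υ
    (measurable_whiten.comp_aemeasurable hpair) hcomp] with y hy
  exact hy.trans (hκ y)

end Whiten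

/-! ### Concentration of the empirical form and of isotropic norms. -/

section Concentration

open Matrix

variable {d n : ℕ} {K : ℝ≥0} {S : Matrix (Fin d) (Fin d) ℝ}
  {ν : Measure (EuclideanSpace ℝ (Fin d))} {Ω : Type*} [MeasurableSpace Ω] {P : Measure Ω}

theorem IsSubG.integral_inner_sq (h : IsSubG K S ν) (w : EuclideanSpace ℝ (Fin d)) :
    ∫ x, inner ℝ w x ^ 2 ∂ν = w.ofLp ⬝ᵥ S *ᵥ w.ofLp := by
  have hexp : ∀ x : EuclideanSpace ℝ (Fin d),
      inner ℝ w x ^ 2 = ∑ k, ∑ l, w k * w l * (x k * x l) := by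
    intro x
    rw [inner_eq_dotProduct, sq, dotProduct, Finset.sum_mul_sum]
    exact Finset.sum_congr rfl fun a _ => Finset.sum_congr rfl fun b _ => by ring
  have hint : ∀ k l, Integrable (fun x : EuclideanSpace ℝ (Fin d) =>
      w k * w l * (x k * x l)) ν := fun k l => (h.integrable_mul k l).const_mul _
  simp only [hexp]
  rw [integral_finsetSum _ fun a _ => integrable_finsetSum _ fun b _ => hint a b]
  simp_rw [integral_finsetSum _ fun b _ => hint _ b, integral_const_mul, h.secondMoment]
  simp only [dotProduct, mulVec, Finset.mul_sum]
  exact Finset.sum_congr rfl fun a _ => Finset.sum_congr rfl fun b _ => by ring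

theorem invSqrt_mulVec_dotProduct_mulVec (hS : S.PosDef) (v : Fin d → ℝ) :
    (invSqrt S *ᵥ v) ⬝ᵥ S *ᵥ (invSqrt S *ᵥ v) = v ⬝ᵥ v := by
  rw [invSqrt_mulVec_dotProduct, mulVec_mulVec, mulVec_mulVec, invSqrt_mul_mul_invSqrt hS,
    one_mulVec]

theorem norm_sq_eq_dotProduct (v : EuclideanSpace ℝ (Fin d)) : ‖v‖ ^ 2 = v.ofLp ⬝ᵥ v.ofLp := by
  rw [← real_inner_self_eq_norm_sq, inner_eq_dotProduct]

/-- Concentration of the empirical second moment in a fixed direction. -/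
theorem measureReal_abs_sum_inner_sq_sub_ge_le [IsProbabilityMeasure P] (h : IsSubG K S ν)
    {υ : Fin n → Ω → EuclideanSpace ℝ (Fin d)} (hυ : ∀ j, HasLaw (υ j) ν P)
    (hind : iIndepFun υ P) {w : EuclideanSpace ℝ (Fin d)} (hw : w.ofLp ⬝ᵥ S *ᵥ w.ofLp = 1) :
    P.real {ω | n * (1 / 4 : ℝ) ≤ |∑ j, inner ℝ w (υ j ω) ^ 2 - n|} ≤
      2 * Real.exp (-(n / (1024 * ((K : ℝ) + 1) ^ 4))) := by
  set L : ℝ := (K : ℝ) + 1 with hL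
  have hL1 : 1 ≤ L := by simp [hL]
  have hLpos : 0 < L := by linarith
  have hf : Measurable fun x : EuclideanSpace ℝ (Fin d) => inner ℝ w x ^ 2 / L ^ 2 := by fun_prop
  -- Dividing by `L²` normalises the exponential moment and makes the mean `1 / L²`. The deviation
  -- `t` is a quarter of it, so `t² / 64 = 1 / (1024 L⁴)`.
  have key := measureReal_abs_sum_sub_ge_le (μ := P)
    (Y := fun j ω => inner ℝ w (υ j ω) ^ 2 / L ^ 2) (m := 1 / L ^ 2) (t := 1 / (4 * L ^ 2))
    (fun j => hf.comp_aemeasurable (hυ j).aemeasurable) (fun j ω => by positivity)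
    (fun j => by
      rw [(hυ j).lintegral_comp (f := fun x => ENNReal.ofReal (Real.exp (inner ℝ w x ^ 2 / L ^ 2)))
        (by fun_prop)]
      exact h.lintegral_exp_inner_sq_le hw)
    (hind.comp _ fun _ => hf)
    (fun j => by
      have := (hυ j).integral_comp (f := fun x => inner ℝ w x ^ 2 / L ^ 2)
        hf.aestronglyMeasurable
      simp only [Function.comp_def] at this
      rw [this, integral_div, h.integral_inner_sq, hw])
    (by positivity)
    (by rw [div_le_iff₀ (by positivity)]; nlinarith)
  refine le_trans (le_of_eq ?_) (key.trans (le_of_eq ?_))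
  · congr 1
    ext ω
    simp only [Set.mem_ofPred_eq]
    rw [← Finset.sum_div, mul_one_div, mul_one_div, mul_one_div, ← sub_div, abs_div,
      abs_of_pos (pow_pos hLpos 2), mul_comm 4, div_mul_eq_div_div_swap,
      div_le_div_iff_of_pos_right (by positivity)]
  · congr 3
    field_simp
    ring

theorem dotProduct_le_five_mul_secondMomentEstimate (hS : S.PosDef) (hn : 0 < n)
    {y : Fin n → EuclideanSpace ℝ (Fin d)} {N : Finset (EuclideanSpace ℝ (Fin d))}
    (hN : ∀ u : EuclideanSpace ℝ (Fin d), ‖u‖ = 1 → ∃ v ∈ N, ‖u - v‖ ≤ 1 / 4)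
    (hy : ∀ v ∈ N, |∑ j, inner ℝ (WithLp.toLp 2 (invSqrt S *ᵥ v.ofLp)) (y j) ^ 2 - n| <
      n * (1 / 4 : ℝ)) (u : Fin d → ℝ) :
    u ⬝ᵥ S *ᵥ u ≤ 5 * (u ⬝ᵥ secondMomentEstimate y *ᵥ u) := by
  let A : EuclideanSpace ℝ (Fin d) →L[ℝ] EuclideanSpace ℝ (Fin n) :=
    (Matrix.toEuclideanLin (dataMatrix y * invSqrt S)).toContinuousLinearMap
  have hA : ∀ v, ‖A v‖ ^ 2 = ∑ j, ((y j).ofLp ⬝ᵥ (invSqrt S *ᵥ v.ofLp)) ^ 2 := by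
    intro v
    rw [EuclideanSpace.norm_sq_eq]
    refine Finset.sum_congr rfl fun j _ => ?_
    rw [Real.norm_eq_abs, sq_abs]
    simp only [A, LinearMap.coe_toContinuousLinearMap', Matrix.toLpLin_apply, ← mulVec_mulVec]
    rfl
  have hbd : ∀ v ∈ N, |‖A v‖ ^ 2 - n| < n * (1 / 4 : ℝ) := fun v hv => by
    have := hy v hv
    simp only [inner_eq_dotProduct] at this
    rwa [hA]
  have hST : S.transpose = S := by simpa [Matrix.IsHermitian] using hS.isHermitian
  have hTTS : ∀ z, invSqrt S *ᵥ (invSqrt S *ᵥ (S *ᵥ z)) = z := fun z => by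
    rw [mulVec_mulVec, mulVec_mulVec, mul_eq_one_comm.1 (mul_invSqrt_mul_invSqrt hS), one_mulVec]
  have key := mul_norm_sq_le_of_quarter_net A hN (c := n) (by positivity)
    (fun v hv => by linarith [(abs_lt.1 (hbd v hv)).1])
    (fun v hv => by linarith [(abs_lt.1 (hbd v hv)).2])
    -- This vector is `S^{1/2} u`: the map `Υ S^{-1/2}` sends it to `Υ u`, and its squared norm is
    -- `u·Su`.
    (WithLp.toLp 2 (invSqrt S *ᵥ (S *ᵥ u)))
  rw [hA, norm_sq_eq_dotProduct] at key
  simp only [hTTS] at key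
  rw [invSqrt_mulVec_dotProduct, hTTS, dotProduct_comm] at key
  rw [dotProduct_secondMomentEstimate_mulVec]
  have hn' : (0 : ℝ) < n := by exact_mod_cast hn
  rw [one_div, mul_left_comm, ← div_eq_inv_mul, le_div_iff₀ hn']
  linarith

theorem posDef_secondMomentEstimate_of_le {y : Fin n → EuclideanSpace ℝ (Fin d)} (hS : S.PosDef)
    {c : ℝ} (h : ∀ u, u ⬝ᵥ S *ᵥ u ≤ c * (u ⬝ᵥ secondMomentEstimate y *ᵥ u)) :
    (secondMomentEstimate y).PosDef := by
  have hpsd := posSemidef_secondMomentEstimate y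
  refine PosDef.of_dotProduct_mulVec_pos hpsd.isHermitian fun u hu => ?_
  have h1 := hS.dotProduct_mulVec_pos hu
  have h2 := hpsd.dotProduct_mulVec_nonneg u
  simp only [star_trivial] at *
  refine h2.lt_of_ne fun h0 => ?_
  have := h u
  rw [← h0] at this
  linarith

/-- Tail bound for the squared norm of the isotropic vector `S^{-1/2} x`. -/
theorem IsSubG.measureReal_lt_le (h : IsSubG K S ν) (hS : S.PosDef) (t : ℝ) :
    ν.real {x | d * ((K : ℝ) + 1) ^ 2 * t < (invSqrt S *ᵥ x.ofLp) ⬝ᵥ (invSqrt S *ᵥ x.ofLp)} ≤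
      2 * Real.exp (-t) := by
  have := h.isProbabilityMeasure
  set L : ℝ := (K : ℝ) + 1 with hL
  have hLpos : 0 < L := by positivity
  rcases Nat.eq_zero_or_pos d with rfl | hd
  · simp [dotProduct]
    positivity
  have hd' : (0 : ℝ) < d := by exact_mod_cast hd
  let w : Fin d → EuclideanSpace ℝ (Fin d) := fun k =>
    WithLp.toLp 2 (invSqrt S *ᵥ Pi.single k 1)
  have hw : ∀ k, (w k).ofLp ⬝ᵥ S *ᵥ (w k).ofLp = 1 := fun k => by
    have := invSqrt_mulVec_dotProduct_mulVec hS (Pi.single k 1)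
    rwa [dotProduct_single, Pi.single_eq_same, one_mul] at this
  have hcoord : ∀ (x : EuclideanSpace ℝ (Fin d)) k,
      (invSqrt S *ᵥ x.ofLp) k = inner ℝ (w k) x := fun x k => by
    rw [inner_eq_dotProduct, ← invSqrt_mulVec_dotProduct]
    simp
  -- By Jensen, `exp (‖S^{-1/2} x‖² / (d L²)) ≤ f x`, and `f` has mean at most 2, so Markov applies.
  -- Averaging over coordinates avoids the `log d` of a union bound.
  let f : EuclideanSpace ℝ (Fin d) → ℝ := fun x =>
    ∑ k, (1 / d : ℝ) * Real.exp (inner ℝ (w k) x ^ 2 / L ^ 2)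
  have hf : ∫⁻ x, ENNReal.ofReal (f x) ∂ν ≤ 2 := by
    have : ∀ x, ENNReal.ofReal (f x) = ∑ k, ENNReal.ofReal (1 / d : ℝ) *
        ENNReal.ofReal (Real.exp (inner ℝ (w k) x ^ 2 / L ^ 2)) := fun x => by
      rw [ENNReal.ofReal_sum_of_nonneg fun k _ => by positivity]
      exact Finset.sum_congr rfl fun k _ => ENNReal.ofReal_mul (by positivity)
    simp only [this]
    rw [lintegral_finsetSum _ fun k _ => by fun_prop]
    calc _ ≤ ∑ _k : Fin d, ENNReal.ofReal (1 / d : ℝ) * 2 := by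
          refine Finset.sum_le_sum fun k _ => ?_
          rw [lintegral_const_mul _ (by fun_prop)]
          gcongr
          exact h.lintegral_exp_inner_sq_le (hw k)
      _ = 2 := by
          rw [Finset.sum_const, Finset.card_univ, Fintype.card_fin, nsmul_eq_mul, ← mul_assoc,
            ← ENNReal.ofReal_natCast, ← ENNReal.ofReal_mul (by positivity),
            mul_one_div_cancel hd'.ne', ENNReal.ofReal_one, one_mul]
  have hsub : {x : EuclideanSpace ℝ (Fin d) |
      d * L ^ 2 * t < (invSqrt S *ᵥ x.ofLp) ⬝ᵥ (invSqrt S *ᵥ x.ofLp)} ⊆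
      {x | ENNReal.ofReal (Real.exp t) ≤ ENNReal.ofReal (f x)} := by
    intro x hx
    simp only [Set.mem_ofPred_eq] at hx ⊢
    refine ENNReal.ofReal_le_ofReal ?_
    have hJ := convexOn_exp.map_sum_le (t := Finset.univ) (w := fun _ : Fin d => (1 / d : ℝ))
      (p := fun k => inner ℝ (w k) x ^ 2 / L ^ 2) (fun _ _ => by positivity)
      (by simp [hd'.ne']) (fun _ _ => Set.mem_univ _)
    simp only [smul_eq_mul] at hJ
    refine le_trans (Real.exp_le_exp.2 ?_) hJ
    have hsum : (invSqrt S *ᵥ x.ofLp) ⬝ᵥ (invSqrt S *ᵥ x.ofLp) = ∑ k, inner ℝ (w k) x ^ 2 := by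
      simp only [dotProduct, hcoord, sq]
    rw [← Finset.mul_sum, ← Finset.sum_div, ← hsum, one_div, ← div_eq_inv_mul, div_div,
      le_div_iff₀ (by positivity)]
    linarith
  have hmark : ENNReal.ofReal (Real.exp t) *
      ν {x | ENNReal.ofReal (Real.exp t) ≤ ENNReal.ofReal (f x)} ≤ 2 :=
    (mul_meas_ge_le_lintegral (by fun_prop) _).trans hf
  have hreal := ENNReal.toReal_mono (by simp) hmark
  rw [ENNReal.toReal_mul, ENNReal.toReal_ofReal (Real.exp_pos _).le] at hreal
  rw [Real.exp_neg, ← div_eq_mul_inv, le_div_iff₀ (Real.exp_pos _), mul_comm]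
  refine le_trans (mul_le_mul_of_nonneg_left (measureReal_mono hsub) (Real.exp_pos _).le) ?_
  simpa [measureReal_def] using hreal

end Concentration

/-! ### Union bounds and the final estimate. -/

section Main

open Matrix

variable {d : ℕ} {K : ℝ≥0} {S : Matrix (Fin d) (Fin d) ℝ} {Ω : Type*} [MeasurableSpace Ω]
  {P : Measure Ω}

theorem indepFun_pi_of_iIndepFun_sumElim [IsProbabilityMeasure P] {ι κ E : Type*} [Fintype κ]
    [MeasurableSpace E] {ξ : ι → Ω → E} {υ : κ → Ω → E} (hξ : ∀ i, AEMeasurable (ξ i) P)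
    (hυ : ∀ j, AEMeasurable (υ j) P) (hind : iIndepFun (Sum.elim ξ υ) P) (i : ι) :
    IndepFun (fun ω j => υ j ω) (ξ i) P := by
  classical
  have h := hind.indepFun_finset₀ (Finset.univ.map ⟨Sum.inr, Sum.inr_injective⟩) {Sum.inl i}
    (by simp) (by rintro (a | b); exacts [hξ a, hυ b])
  have hφ : Measurable fun (x : (Finset.univ.map (⟨Sum.inr, Sum.inr_injective⟩ : κ ↪ ι ⊕ κ)) → E)
      (j : κ) => x ⟨Sum.inr j, by simp⟩ := by fun_prop
  have hψ : Measurable fun x : ({Sum.inl i} : Finset (ι ⊕ κ)) → E => x ⟨Sum.inl i, by simp⟩ := by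
    fun_prop
  exact h.comp hφ hψ

theorem nine_pow_mul_exp_neg_le {d : ℕ} {a b : ℝ} (hb : 0 ≤ b) (ha : 4 * (d + b) ≤ a) :
    (9 : ℝ) ^ d * Real.exp (-a) ≤ Real.exp (-b) := by
  have h9 : (9 : ℝ) ≤ Real.exp 4 := by
    have := Real.quadratic_le_exp_of_nonneg (x := 4) (by norm_num)
    linarith
  calc (9 : ℝ) ^ d * Real.exp (-a) ≤ Real.exp 4 ^ d * Real.exp (-a) := by gcongr
    _ = Real.exp (d * 4 - a) := by rw [← Real.exp_nat_mul, ← Real.exp_add]; rfl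
    _ ≤ Real.exp (-b) := Real.exp_le_exp.2 (by linarith)

/-- With high probability the empirical second moment dominates a fifth of the true one. -/
theorem measureReal_not_le_five_mul_secondMomentEstimate_le [IsProbabilityMeasure P] {n : ℕ}
    {ν : Measure (EuclideanSpace ℝ (Fin d))} (hS : S.PosDef) (h : IsSubG K S ν)
    {υ : Fin n → Ω → EuclideanSpace ℝ (Fin d)} (hυ : ∀ j, HasLaw (υ j) ν P)
    (hind : iIndepFun υ P) {η : ℝ} (hη : 0 < η) (hη1 : η < 1)
    (hn : 64 * ((K : ℝ) + 1) ^ 2 * (√d + √(Real.log (1 / η))) ≤ √n) :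
    P.real {ω | ¬ ∀ u, u ⬝ᵥ S *ᵥ u ≤
      5 * (u ⬝ᵥ secondMomentEstimate (fun j => υ j ω) *ᵥ u)} ≤ 2 * η := by
  have hlog : 0 < Real.log (1 / η) := Real.log_pos ((one_lt_div hη).2 hη1)
  set L : ℝ := (K : ℝ) + 1 with hL
  have hLpos : 0 < L := by positivity
  have hsum : 0 < √(d : ℝ) + √(Real.log (1 / η)) :=
    add_pos_of_nonneg_of_pos (Real.sqrt_nonneg _) (Real.sqrt_pos.2 hlog)
  have hn0 : 0 < n := by
    have : 0 < √(n : ℝ) := lt_of_lt_of_le (by positivity) hn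
    exact_mod_cast Real.sqrt_pos.1 this
  -- Source of the 64: `64² = 4 * 1024`. The share `4d` pays for the `9^d` net points, the rest for
  -- `η`.
  have hn2 : 4 * (d + Real.log (1 / η)) ≤ n / (1024 * L ^ 4) := by
    rw [le_div_iff₀ (by positivity)]
    have h1 := pow_le_pow_left₀ (by positivity) hn 2
    rw [Real.sq_sqrt (by positivity), mul_pow, add_sq √(d : ℝ), Real.sq_sqrt (by positivity),
      Real.sq_sqrt hlog.le] at h1
    have h2 : 0 ≤ (64 * L ^ 2) ^ 2 * (2 * √(d : ℝ) * √(Real.log (1 / η))) := by positivity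
    nlinarith
  obtain ⟨N, hNcard, hN1, hN⟩ := exists_quarter_net_sphere (EuclideanSpace ℝ (Fin d))
  rw [finrank_euclideanSpace_fin] at hNcard
  let w : EuclideanSpace ℝ (Fin d) → EuclideanSpace ℝ (Fin d) :=
    fun v => WithLp.toLp 2 (invSqrt S *ᵥ v.ofLp)
  let B : EuclideanSpace ℝ (Fin d) → Set Ω :=
    fun v => {ω | n * (1 / 4 : ℝ) ≤ |∑ j, inner ℝ (w v) (υ j ω) ^ 2 - n|}
  have hB : ∀ v ∈ N, P.real (B v) ≤ 2 * Real.exp (-(n / (1024 * L ^ 4))) := fun v hv =>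
    measureReal_abs_sum_inner_sq_sub_ge_le h hυ hind (by
      simp only [w]
      rw [invSqrt_mulVec_dotProduct_mulVec hS, ← norm_sq_eq_dotProduct, hN1 v hv, one_pow])
  have hsub : {ω | ¬ ∀ u, u ⬝ᵥ S *ᵥ u ≤
      5 * (u ⬝ᵥ secondMomentEstimate (fun j => υ j ω) *ᵥ u)} ⊆ ⋃ v ∈ N, B v := by
    intro ω hω
    by_contra hcon
    simp only [Set.mem_iUnion, not_exists] at hcon
    exact hω (dotProduct_le_five_mul_secondMomentEstimate hS hn0 hN
      fun v hv => not_le.1 (hcon v hv))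
  have hcard : (N.card : ℝ) ≤ 9 ^ d := by exact_mod_cast hNcard
  calc _ ≤ P.real (⋃ v ∈ N, B v) := measureReal_mono hsub (measure_ne_top _ _)
    _ ≤ ∑ v ∈ N, P.real (B v) := measureReal_biUnion_finset_le _ _
    _ ≤ ∑ _v ∈ N, 2 * Real.exp (-(n / (1024 * L ^ 4))) := Finset.sum_le_sum hB
    _ = 2 * (N.card * Real.exp (-(n / (1024 * L ^ 4)))) := by
        rw [Finset.sum_const, nsmul_eq_mul]; ring
    _ ≤ 2 * (9 ^ d * Real.exp (-(n / (1024 * L ^ 4)))) := by gcongr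
    _ ≤ 2 * Real.exp (-Real.log (1 / η)) := by
        gcongr
        exact nine_pow_mul_exp_neg_le hlog.le hn2
    _ = 2 * η := by rw [one_div, Real.log_inv, neg_neg, Real.exp_log hη]

theorem measureReal_exists_isotropic_norm_gt_le [IsProbabilityMeasure P] {n : ℕ}
    {ν : Measure (EuclideanSpace ℝ (Fin d))} (hS : S.PosDef) (h : IsSubG K S ν)
    {ξ : Fin n → Ω → EuclideanSpace ℝ (Fin d)} (hξ : ∀ i, HasLaw (ξ i) ν P) {η : ℝ}
    (hη : 0 < η) :
    P.real {ω | ∃ i, d * ((K : ℝ) + 1) ^ 2 * Real.log (2 * n / η) <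
      (invSqrt S *ᵥ (ξ i ω).ofLp) ⬝ᵥ (invSqrt S *ᵥ (ξ i ω).ofLp)} ≤ η := by
  rcases Nat.eq_zero_or_pos n with rfl | hn
  · simpa using hη.le
  have hn' : (0 : ℝ) < n := by exact_mod_cast hn
  rw [Set.ofPred_exists]
  refine (measureReal_iUnion_fintype_le _).trans ?_
  have hi : ∀ i, P.real {ω | d * ((K : ℝ) + 1) ^ 2 * Real.log (2 * n / η) <
      (invSqrt S *ᵥ (ξ i ω).ofLp) ⬝ᵥ (invSqrt S *ᵥ (ξ i ω).ofLp)} ≤ η / n := by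
    intro i
    rw [(hξ i).measureReal_eq (p := fun x => d * ((K : ℝ) + 1) ^ 2 * Real.log (2 * n / η) <
      (invSqrt S *ᵥ x.ofLp) ⬝ᵥ (invSqrt S *ᵥ x.ofLp))]
    · refine (h.measureReal_lt_le hS _).trans_eq ?_
      rw [Real.exp_neg, Real.exp_log (by positivity)]
      field_simp
    · refine measurableSet_lt measurable_const ?_
      simp only [dotProduct, mulVec]
      fun_prop
  refine (Finset.sum_le_sum fun i _ => hi i).trans_eq ?_
  rw [Finset.sum_const, Finset.card_univ, Fintype.card_fin, nsmul_eq_mul]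
  field_simp

end Main

theorem corollary3p2 (K : ℝ≥0) :
    ∃ C₀ C₁ C₂ : ℝ, 0 < C₀ ∧ 0 < C₁ ∧ 0 < C₂ ∧
      ∀ (d nξ nυ : ℕ) (S : Matrix (Fin d) (Fin d) ℝ), S.PosDef →
      ∀ (Ω : Type*) [MeasurableSpace Ω] (P : Measure Ω) [IsProbabilityMeasure P]
        (νξ νυ : Measure (EuclideanSpace ℝ (Fin d)))
        (ξ : Fin nξ → Ω → EuclideanSpace ℝ (Fin d))
        (υ : Fin nυ → Ω → EuclideanSpace ℝ (Fin d)),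
        IsSubG K S νξ → IsSubG K S νυ →
        (∀ i, HasLaw (ξ i) νξ P) → (∀ j, HasLaw (υ j) νυ P) →
        iIndepFun (Sum.elim ξ υ) P →
        -- conditionally on the public data, each whitened private vector is `subG(Σ̃)`
        (∀ i, ∀ᵐ y ∂(P.map fun ω j => υ j ω), (secondMomentEstimate y).PosDef →
          IsSubG K (whitenedMoment y S)
            (condDistrib (fun ω => whiten (fun j => υ j ω) (ξ i ω)) (fun ω j => υ j ω) P y)) ∧
        ∀ η : ℝ, 0 < η → η < 1 →
          C₀ * (Real.sqrt d + Real.sqrt (Real.log (1 / η))) ≤ Real.sqrt nυ →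
          1 - 3 * η ≤ P.real {ω |
            (secondMomentEstimate fun j => υ j ω).PosDef ∧
            ∀ i,
              ‖whiten (fun j => υ j ω) (ξ i ω)‖ ^ 2 ≤
                (whitenedMoment (fun j => υ j ω) S).trace
                  + C₁ * (d * Real.log (2 * nξ / η)) ∧
              (whitenedMoment (fun j => υ j ω) S).trace
                  + C₁ * (d * Real.log (2 * nξ / η)) ≤
                C₂ * (d * (1 + Real.log (2 * nξ / η)))} := by
  -- `C₁` is the form constant 5 times `L²` from the isotropic tail. The same value serves as `C₂`,
  -- because `Tr Σ̃ ≤ 5d ≤ 5 L² d`.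
  refine ⟨64 * ((K : ℝ) + 1) ^ 2, 5 * ((K : ℝ) + 1) ^ 2, 5 * ((K : ℝ) + 1) ^ 2, by positivity,
    by positivity, by positivity, ?_⟩
  intro d nξ nυ S hS Ω _ P _ νξ νυ ξ υ hνξ hνυ hξ hυ hind
  refine ⟨fun i => ?_, fun η hη hη1 hn => ?_⟩
  · have := hνξ.isProbabilityMeasure
    filter_upwards [condDistrib_whiten_ae_eq (hξ i)
      (aemeasurable_pi_lambda _ fun j => (hυ j).aemeasurable)
      (indepFun_pi_of_iIndepFun_sumElim (fun i => (hξ i).aemeasurable)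
        (fun j => (hυ j).aemeasurable) hind i)] with y hy _
    rw [hy]
    exact hνξ.map_whiten y
  have hυind : iIndepFun υ P := hind.precomp (g := Sum.inr) Sum.inr_injective
  have h1 := measureReal_not_le_five_mul_secondMomentEstimate_le hS hνυ hυ hυind hη hη1 hn
  have h2 := measureReal_exists_isotropic_norm_gt_le hS hνξ hξ hη
  set B₁ := {ω | ¬ ∀ u, u ⬝ᵥ S.mulVec u ≤
    5 * (u ⬝ᵥ (secondMomentEstimate fun j => υ j ω).mulVec u)}
  set B₂ := {ω | ∃ i, d * ((K : ℝ) + 1) ^ 2 * Real.log (2 * nξ / η) <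
    ((invSqrt S).mulVec (ξ i ω).ofLp) ⬝ᵥ ((invSqrt S).mulVec (ξ i ω).ofLp)}
  set G := {ω | (secondMomentEstimate fun j => υ j ω).PosDef ∧ ∀ i,
    ‖whiten (fun j => υ j ω) (ξ i ω)‖ ^ 2 ≤ (whitenedMoment (fun j => υ j ω) S).trace
      + 5 * ((K : ℝ) + 1) ^ 2 * (d * Real.log (2 * nξ / η)) ∧
    (whitenedMoment (fun j => υ j ω) S).trace
      + 5 * ((K : ℝ) + 1) ^ 2 * (d * Real.log (2 * nξ / η)) ≤
        5 * ((K : ℝ) + 1) ^ 2 * (d * (1 + Real.log (2 * nξ / η)))}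
  -- Covering the whole space needs only subadditivity, so no measurability of `G`, `B₁` or `B₂` is
  -- required.
  have hcover : (Set.univ : Set Ω) ⊆ G ∪ (B₁ ∪ B₂) := by
    intro ω _
    by_cases hB₁ : ω ∈ B₁
    · exact Or.inr (Or.inl hB₁)
    by_cases hB₂ : ω ∈ B₂
    · exact Or.inr (Or.inr hB₂)
    left
    have hdom := not_not.1 hB₁
    have hpd := posDef_secondMomentEstimate_of_le hS hdom
    refine ⟨hpd, fun i => ?_⟩
    have hnorm := dotProduct_invSqrt_mulVec_le (by norm_num) hS hpd hdom (ξ i ω).ofLp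
    have hiso := not_lt.1 (not_exists.1 hB₂ i)
    have htr := trace_invSqrt_mul_mul_invSqrt_le hpd hS hdom
    have htr0 := trace_invSqrt_mul_mul_invSqrt_nonneg
      (M := secondMomentEstimate fun j => υ j ω) hS
    rw [norm_sq_eq_dotProduct]
    simp only [whiten, whitenedMoment]
    have hK : (0 : ℝ) ≤ K := K.2
    have hL : (1 : ℝ) ≤ ((K : ℝ) + 1) ^ 2 := by nlinarith
    have hd : (d : ℝ) ≤ ((K : ℝ) + 1) ^ 2 * d := le_mul_of_one_le_left (by positivity) hL
    constructor <;> linarith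
  have hG := (measureReal_mono (μ := P) hcover).trans
    ((measureReal_union_le _ _).trans (add_le_add_right (measureReal_union_le _ _) _))
  rw [probReal_univ] at hG
  linarith
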